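/- \textbf{Jacket bound.} Let $D\ge 2$ and let $\mathcal G$ be a connected $(D+1)$-colored graph: a finite bipartite multigraph with $2p$ vertices in which every vertex is incident to exactly one line of each color $0,\dots,D$, all lines being oriented from the white to the black vertices. Its faces of colors $i<j$ are the closed circuits alternating between lines of colors $i$ and $j$, oriented along their lines of color $i$; $\mathcal L_{\mathcal G}$ and $\mathcal F_{\mathcal G}$ are the sets of its lines and faces. For each cyclic permutation $\tau$ of all $D+1$ colors, taken modulo orientation ($\tau\sim\tau^{-1}$), the jacket $\mathcal J$ of $\mathcal G$ is the ribbon graph with the same vertices and lines as $\mathcal G$ and whose faces are the faces of $\mathcal G$ of colors $\{i,\tau(i)\}$; its genus $g_{\mathcal J}$ is given by $2-2g_{\mathcal J}=\#\text{vertices}-\#\text{lines}+\#\text{faces}$. The degree of $\mathcal G$ is $\omega(\mathcal G)=\sum_{\mathcal J} g_{\mathcal J}$. Let $G$ be a compact second countable topological group (for instance a compact Lie group) with unit $e$ and Haar probability measure $dh$, and let $\delta:G\to\mathbb R$ be a regularized delta function (for instance a heat kernel at a positive time): a continuous function with $0\le\delta(h)\le\delta(e)$, $\int\delta(h)\,dh=1$,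 $\delta(gh)=\delta(hg)$ and $\delta(h^{-1})=\delta(h)$ for all $g,h\in G$. Let $\lambda\in\mathbb C$. The amplitude of $\mathcal G$ in the Boulatov--Ooguri model is $$A^{\mathrm{BO}}(\mathcal G)=\frac{(\lambda\bar\lambda)^p}{\delta(e)^{p(D-2)(D-1)/2}}\int\prod_{\ell\in\mathcal L_{\mathcal G}}dh_\ell\prod_{f\in\mathcal F_{\mathcal G}}\delta\Big(\prod_{\ell\in f}^{\rightarrow}h_\ell^{\sigma^{\ell|f}}\Big),$$ where the inner product is taken in order along the face $f$ and $\sigma^{\ell|f}=1$ (resp. $-1$) if the orientations of $\ell$ and $f$ agree (resp. are opposite). Then $$A^{\mathrm{BO}}(\mathcal G)\le(\lambda\bar\lambda)^p\,\delta(e)^{\,D-1-\frac{2(D-2)}{D!}\,\omega(\mathcal G)}.$$ -/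

import Mathlib

open MeasureTheory
open scoped Nat

noncomputable section

/-- A `(D+1)`-coloured graph with set of white vertices `W` and set of black vertices `B`.
At every vertex there is exactly one half line of each colour `0, …, D`, and every line joins a
white vertex to a black one (all lines are oriented from white to black).
The line of colour `c` at the white vertex `w` ends at the black vertex `line c w`;
this line is denoted by the pair `(c, w)`. Multiple lines are allowed. -/
structure ColoredGraph (D : ℕ) (W B : Type*) where
  line : Fin (D + 1) → W ≃ B

/-- The unordered pairs of distinct colours, each written in increasing order. -/
abbrev ColorPair (D : ℕ) : Type := {c : Fin (D + 1) × Fin (D + 1) // c.1 < c.2}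

/-- The set of colour pairs `{i, τ i}` met along a permutation `τ` of the colours. -/
def jacketOf {D : ℕ} (τ : Equiv.Perm (Fin (D + 1))) : Finset (ColorPair D) :=
  Finset.univ.filter fun c => τ c.1.1 = c.1.2 ∨ τ c.1.2 = c.1.1

open Classical in
/-- The jackets: cyclic permutations `τ` of all `D + 1` colours modulo orientation
(`τ` and `τ⁻¹` being identified), each recorded as its set of colour pairs `{i, τ i}`. -/
def jackets (D : ℕ) : Finset (Finset (ColorPair D)) :=
  (Finset.univ.filter fun τ : Equiv.Perm (Fin (D + 1)) =>
    τ.IsCycle ∧ τ.support = Finset.univ).image jacketOf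

namespace ColoredGraph

variable {D : ℕ} {W B : Type*}

/-- The underlying simple graph on all the vertices. -/
def toSimpleGraph (Γ : ColoredGraph D W B) : SimpleGraph (W ⊕ B) :=
  SimpleGraph.fromRel fun x y => ∃ c w, x = Sum.inl w ∧ y = Sum.inr (Γ.line c w)

/-- The graph is connected (in particular non-empty). -/
def IsConnected (Γ : ColoredGraph D W B) : Prop := Γ.toSimpleGraph.Connected

/-- From a white vertex, follow the line of the first colour of `c` to a black vertex, then the
line of the second colour of `c` (against its orientation) back to a white vertex. -/
def step (Γ : ColoredGraph D W B) (c : ColorPair D) : Equiv.Perm W :=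
  (Γ.line c.1.1).trans (Γ.line c.1.2).symm

/-- The faces of colours `c`: the closed circuits alternating between the two colours of `c`
(connected components of the subgraph with these two colours), each given by the set of its
white vertices. -/
def Face (Γ : ColoredGraph D W B) (c : ColorPair D) : Type _ :=
  Quotient (Equiv.Perm.SameCycle.setoid (Γ.step c))

instance (Γ : ColoredGraph D W B) (c : ColorPair D) [Fintype W] : Fintype (Γ.Face c) :=
  @Fintype.ofFinite _ (Quotient.finite _)

/-- The oriented product of the group elements `h` of the lines along the face of colours `c`
through the white vertex `w`, starting at `w`. The face is oriented along its lines of the first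
colour, which enter with exponent `1`; its lines of the second colour enter with exponent `-1`. -/
def holonomy {G : Type*} [Group G] (Γ : ColoredGraph D W B) (c : ColorPair D)
    (h : Fin (D + 1) × W → G) (w : W) : G :=
  ((List.range (Function.minimalPeriod (Γ.step c) w)).map fun k =>
    h (c.1.1, ((Γ.step c)^[k]) w) * (h (c.1.2, ((Γ.step c)^[k + 1]) w))⁻¹).prod

/-- Moving the starting point along a face conjugates the oriented product. -/
theorem holonomy_step {G : Type*} [Group G] [Finite W] (Γ : ColoredGraph D W B)
    (c : ColorPair D) (h : Fin (D + 1) × W → G) (w : W) :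
    ∃ g : G, Γ.holonomy c h (Γ.step c w) = g⁻¹ * Γ.holonomy c h w * g := by
  set a : ℕ → G := fun k =>
    h (c.1.1, ((Γ.step c)^[k]) w) * (h (c.1.2, ((Γ.step c)^[k + 1]) w))⁻¹ with ha
  set n := Function.minimalPeriod (Γ.step c) w with hn
  have hper : w ∈ Function.periodicPts (Γ.step c) :=
    (Γ.step c).injective.mem_periodicPts w
  have hn' : Function.minimalPeriod (Γ.step c) (Γ.step c w) = n :=
    Function.minimalPeriod_apply hper
  have hit : ((Γ.step c)^[n]) w = w := Function.iterate_minimalPeriod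
  have han : a n = a 0 := by
    simp only [ha, Function.iterate_succ_apply', hit, Function.iterate_zero, id]
  have h1 : Γ.holonomy c h w = ((List.range n).map a).prod := rfl
  have h2 : Γ.holonomy c h (Γ.step c w) =
      ((List.range n).map fun k => a (k + 1)).prod := by
    unfold holonomy
    rw [hn']
    rfl
  refine ⟨a 0, ?_⟩
  have e1 := List.prod_range_succ a n
  have e2 := List.prod_range_succ' a n
  rw [h1, h2, mul_assoc, eq_inv_mul_iff_mul_eq]
  have e3 := e2.symm.trans e1
  rw [han] at e3
  exact e3

/-- The oriented product of the group elements along a face (with some starting point on it). -/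
def faceHolonomy {G : Type*} [Group G] (Γ : ColoredGraph D W B) {c : ColorPair D}
    (f : Γ.Face c) (h : Fin (D + 1) × W → G) : G :=
  Γ.holonomy c h (Quotient.out f)

/-- The genus `g` of the jacket `J`: the ribbon graph with the same vertices and lines as the
graph and whose faces are the faces with colours in `J`; thus `2 - 2 g` is its number of vertices
minus its number of lines plus its number of faces. -/
def jacketGenus [Fintype W] [Fintype B] (Γ : ColoredGraph D W B) (J : Finset (ColorPair D)) : ℝ :=
  (2 - ((Fintype.card (W ⊕ B) : ℝ) - (Fintype.card (Fin (D + 1) × W) : ℝ)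
    + ∑ c ∈ J, (Fintype.card (Γ.Face c) : ℝ))) / 2

/-- The degree: the sum of the genera of all the jackets. -/
def degree [Fintype W] [Fintype B] (Γ : ColoredGraph D W B) : ℝ :=
  ∑ J ∈ jackets D, Γ.jacketGenus J

end ColoredGraph

section Amplitude

variable {G : Type*} [Group G] [TopologicalSpace G] [IsTopologicalGroup G] [CompactSpace G]
  [MeasurableSpace G] [BorelSpace G]

/-- The Haar measure of total mass one on a compact group. -/
def normalizedHaar (G : Type*) [Group G] [TopologicalSpace G] [IsTopologicalGroup G]
    [CompactSpace G] [MeasurableSpace G] [BorelSpace G] : Measure G :=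
  Measure.haarMeasure ⊤

/-- A regularized (cut-off) delta function at the unit of a compact group, such as the heat kernel
at a positive time: a continuous probability density with respect to the Haar measure, which is
central, invariant under inversion and maximal at the unit. -/
structure IsRegularizedDelta (δ : G → ℝ) : Prop where
  continuous : Continuous δ
  nonneg : ∀ h, 0 ≤ δ h
  integral_eq_one : ∫ h, δ h ∂(normalizedHaar G) = 1
  central : ∀ g h, δ (g * h) = δ (h * g)
  inv : ∀ h, δ h⁻¹ = δ h
  le_unit : ∀ h, δ h ≤ δ 1

/-- For a regularized delta function the factor of a face does not depend on its starting point. -/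
theorem IsRegularizedDelta.holonomy_sameCycle {δ : G → ℝ} (hδ : IsRegularizedDelta δ)
    {D : ℕ} {W B : Type*} [Finite W] (Γ : ColoredGraph D W B) (c : ColorPair D)
    (h : Fin (D + 1) × W → G) {v w : W} (hvw : (Γ.step c).SameCycle v w) :
    δ (Γ.holonomy c h v) = δ (Γ.holonomy c h w) := by
  have hs : ∀ u, δ (Γ.holonomy c h (Γ.step c u)) = δ (Γ.holonomy c h u) := by
    intro u
    obtain ⟨g, hg⟩ := Γ.holonomy_step c h u
    rw [hg, hδ.central, ← mul_assoc, mul_inv_cancel, one_mul]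
  obtain ⟨n, rfl⟩ := hvw.exists_nat_pow_eq
  induction n with
  | zero => simp
  | succ n ih =>
    rw [pow_succ', Equiv.Perm.mul_apply, hs]
    exact ih ⟨n, by simp⟩

/-- The Boulatov–Ooguri amplitude of a graph with `2 p` vertices (so `p` white ones):
`(λ λ̄)^p / δ(e)^(p (D-2)(D-1)/2)` times the integral, over one group element per line, of the
product over all the faces of `δ` at the oriented product along the face. -/
def ColoredGraph.amplitude {D : ℕ} {W B : Type*} [Fintype W] (Γ : ColoredGraph D W B)
    (δ : G → ℝ) (lam : ℂ) : ℝ :=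
  Complex.normSq lam ^ Fintype.card W
      / δ 1 ^ ((Fintype.card W : ℝ) * (((D : ℝ) - 2) * ((D : ℝ) - 1) / 2))
    * ∫ h : Fin (D + 1) × W → G,
        ∏ c : ColorPair D, ∏ f : Γ.Face c, δ (Γ.faceHolonomy f h)
        ∂(Measure.pi fun _ => normalizedHaar G)

end Amplitude

end

/-! Write `p` for the number of white vertices, `F` and `F_J` for the numbers of faces of the graph
and of a jacket `J`.

Analysis: fix a jacket, bound by `δ 1` the factors of all faces off it and of one face on it, and
integrate the rest. These remaining faces `S` form a proper subset of the faces of the jacket. A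
line lies on two faces of a jacket, so connectedness gives a line lying on exactly one face of `S`
(`exists_liesOn_unique`). Integrating over that line turns its face factor, a translate of `δ`, into
`1`; induction on `S` makes the integral of the remaining product exactly `1`. Hence the amplitude
integral is at most `δ 1 ^ (F - F_J + 1)` (`IsRegularizedDelta.integral_le`).

Combinatorics: jackets correspond two-to-one to the `D!` full cycles, and a colour pair is met by `2
(D-1)!` of these. Summing Euler's formula gives `F = D + p D (D-1) / 2 - 2 ω / (D-1)!`
(`two_mul_degree`), and averaging gives a jacket with `g ≤ 2 ω / D!` (`exists_jacketGenus_le`). As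
`F_J = 2 - 2 g + (D-1) p`, the normalization of the amplitude cancels every term in `p`. The
exponent left is `D - 1 - 2 ω / (D-1)! + 2 g`, which is at most the claimed one; monotonicity in the
exponent uses `1 ≤ δ 1`. -/

open Classical in
/-- The cyclic permutations of all `D + 1` colours. -/
noncomputable def fullCycles (D : ℕ) : Finset (Equiv.Perm (Fin (D + 1))) :=
  Finset.univ.filter fun τ => τ.IsCycle ∧ τ.support = Finset.univ

/-! ### Full cycles of the colours and the jackets they define -/

section FullCycles

variable {D : ℕ}

theorem mem_fullCycles {τ : Equiv.Perm (Fin (D + 1))} :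
    τ ∈ fullCycles D ↔ τ.IsCycle ∧ τ.support = Finset.univ := by
  simp [fullCycles]

theorem fullCycles_apply_ne {τ : Equiv.Perm (Fin (D + 1))} (hτ : τ ∈ fullCycles D)
    (i : Fin (D + 1)) : τ i ≠ i := by
  rw [← Equiv.Perm.mem_support, (mem_fullCycles.1 hτ).2]
  exact Finset.mem_univ i

/-- A property of colours which is invariant under a full cycle is constant. -/
theorem fullCycles_iff_of_invariant {τ : Equiv.Perm (Fin (D + 1))} (hτ : τ ∈ fullCycles D)
    {P : Fin (D + 1) → Prop} (hP : ∀ i, P i ↔ P (τ i)) (i j : Fin (D + 1)) : P i ↔ P j := by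
  obtain ⟨n, rfl⟩ := ((mem_fullCycles.1 hτ).1.sameCycle (fullCycles_apply_ne hτ i)
    (fullCycles_apply_ne hτ j)).exists_nat_pow_eq
  induction n with
  | zero => simp
  | succ n ih => rw [pow_succ', Equiv.Perm.mul_apply, ← hP, ih]

theorem inv_mem_fullCycles {τ : Equiv.Perm (Fin (D + 1))} (hτ : τ ∈ fullCycles D) :
    τ⁻¹ ∈ fullCycles D := by
  rw [mem_fullCycles] at *
  exact ⟨hτ.1.inv, by rw [Equiv.Perm.support_inv, hτ.2]⟩

/-- On at least three colours a full cycle has no orbit of length two. -/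
theorem fullCycles_apply_apply_ne (hD : 2 ≤ D) {τ : Equiv.Perm (Fin (D + 1))}
    (hτ : τ ∈ fullCycles D) (i : Fin (D + 1)) : τ (τ i) ≠ i := by
  intro h
  -- The orbit `{i, τ i}` would be invariant, hence contain all of the at least three colours.
  have key : ∀ j, j = i ∨ j = τ i := by
    intro j
    refine (fullCycles_iff_of_invariant hτ (P := fun j => j = i ∨ j = τ i) (fun k => ?_) i j).1
      (Or.inl rfl)
    constructor
    · rintro (rfl | rfl)
      · exact Or.inr rfl
      · exact Or.inl h
    · rintro (hk | hk)
      · exact Or.inr (τ.injective (hk.trans h.symm))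
      · exact Or.inl (τ.injective hk)
  have hc : (Finset.univ : Finset (Fin (D + 1))).card ≤ ({i, τ i} : Finset _).card :=
    Finset.card_le_card fun j _ => by simpa using key j
  have := hc.trans (Finset.card_le_two)
  simp at this
  omega

theorem card_fullCycles (hD : 1 ≤ D) : (fullCycles D).card = D ! := by
  have h := Equiv.Perm.card_of_cycleType_singleton (α := Fin (D + 1)) (n := D + 1)
    (by omega) (by simp)
  simp only [Fintype.card_fin, Nat.choose_self, mul_one, Nat.add_sub_cancel] at h
  rw [← h]
  congr 1
  ext τ
  simp only [mem_fullCycles, Finset.mem_filter, Finset.mem_univ, true_and]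
  constructor
  · rintro ⟨h1, h2⟩
    rw [h1.cycleType, h2]
    simp
  · intro h
    have h1 : τ.IsCycle := by
      rw [← Equiv.Perm.card_cycleType_eq_one, h]
      simp
    refine ⟨h1, ?_⟩
    rw [h1.cycleType] at h
    exact Finset.card_eq_iff_eq_univ _ |>.1 (by simpa using h)

theorem conj_mem_fullCycles {τ : Equiv.Perm (Fin (D + 1))} (hτ : τ ∈ fullCycles D)
    (σ : Equiv.Perm (Fin (D + 1))) : σ * τ * σ⁻¹ ∈ fullCycles D := by
  rw [mem_fullCycles] at *
  refine ⟨hτ.1.conj, ?_⟩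
  rw [Equiv.Perm.support_conj, hτ.2]
  simp

/-- Conjugation by `swap k l`, which fixes `i`, carries the full cycles sending `i` to `k` into
those sending `i` to `l`. So the `D!` full cycles split into `D` classes of equal size. -/
theorem card_fullCycles_apply_eq (hD : 1 ≤ D) {i j : Fin (D + 1)} (hij : i ≠ j) :
    ((fullCycles D).filter fun τ => τ i = j).card = (D - 1)! := by
  have hle : ∀ k l : Fin (D + 1), k ≠ i → l ≠ i →
      ((fullCycles D).filter fun τ => τ i = k).card
        ≤ ((fullCycles D).filter fun τ => τ i = l).card := by
    intro k l hk hl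
    refine Finset.card_le_card_of_injOn (fun τ => Equiv.swap k l * τ * (Equiv.swap k l)⁻¹) ?_ ?_
    · intro τ hτ
      simp only [Finset.coe_filter, Set.mem_ofPred_eq] at hτ ⊢
      refine ⟨conj_mem_fullCycles hτ.1 _, ?_⟩
      simp [Equiv.swap_apply_of_ne_of_ne hk.symm hl.symm, hτ.2]
    · intro τ _ τ' _ h
      simpa using h
  have hsum : ∑ k, ((fullCycles D).filter fun τ => τ i = k).card = D ! := by
    rw [← card_fullCycles hD]
    exact (Finset.card_eq_sum_card_fiberwise (fun _ _ => Finset.mem_coe.2 (Finset.mem_univ _))).symm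
  have h0 : ((fullCycles D).filter fun τ => τ i = i).card = 0 := by
    rw [Finset.card_eq_zero, Finset.filter_eq_empty_iff]
    exact fun τ hτ => fullCycles_apply_ne hτ i
  rw [← Finset.add_sum_erase _ _ (Finset.mem_univ i), h0, zero_add,
    Finset.sum_congr rfl (fun k hk => le_antisymm
      (hle k j (Finset.ne_of_mem_erase hk) hij.symm)
      (hle j k hij.symm (Finset.ne_of_mem_erase hk))), Finset.sum_const,
    Finset.card_erase_of_mem (Finset.mem_univ i), Finset.card_univ, Fintype.card_fin,
    Nat.add_sub_cancel, smul_eq_mul, ← Nat.mul_factorial_pred (by omega : D ≠ 0)] at hsum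
  exact Nat.eq_of_mul_eq_mul_left (by omega) hsum

theorem mem_jacketOf {τ : Equiv.Perm (Fin (D + 1))} {c : ColorPair D} :
    c ∈ jacketOf τ ↔ τ c.1.1 = c.1.2 ∨ τ c.1.2 = c.1.1 := by
  simp [jacketOf]

theorem jacketOf_inv (τ : Equiv.Perm (Fin (D + 1))) : jacketOf τ⁻¹ = jacketOf τ := by
  ext c
  simp only [mem_jacketOf, Equiv.Perm.inv_eq_iff_eq]
  constructor <;> rintro (h | h) <;> simp [h]

/-- Each colour pair belongs to the jackets of exactly `2 (D - 1)!` full cycles. -/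
theorem card_fullCycles_mem_jacketOf (hD : 2 ≤ D) (c : ColorPair D) :
    ((fullCycles D).filter fun τ => c ∈ jacketOf τ).card = 2 * (D - 1)! := by
  simp only [mem_jacketOf]
  rw [Finset.filter_or, Finset.card_union_of_disjoint,
    card_fullCycles_apply_eq (by omega) c.2.ne, card_fullCycles_apply_eq (by omega) c.2.ne',
    two_mul]
  rw [Finset.disjoint_filter]
  intro τ hτ h1 h2
  exact fullCycles_apply_apply_ne hD hτ _ (by rw [h1, h2])

/-- The unordered pair of two distinct colours. -/
def colorPairMk (i j : Fin (D + 1)) (h : i ≠ j) : ColorPair D :=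
  ⟨(min i j, max i j), min_lt_max.2 h⟩

theorem colorPairMk_mem_jacketOf {τ : Equiv.Perm (Fin (D + 1))} {i j : Fin (D + 1)} (h : i ≠ j) :
    colorPairMk i j h ∈ jacketOf τ ↔ τ i = j ∨ τ j = i := by
  rw [mem_jacketOf]
  rcases le_total i j with hij | hij
  · simp [colorPairMk, hij]
  · simp [colorPairMk, hij, or_comm]

/-- A jacket is a polygon on the colours. Once its first edge is directed, each next vertex is
forced, because a full cycle on at least three colours never backtracks. -/
theorem eq_of_jacketOf_eq_of_apply_eq (hD : 2 ≤ D) {σ τ : Equiv.Perm (Fin (D + 1))}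
    (hσ : σ ∈ fullCycles D) (hτ : τ ∈ fullCycles D) (h : jacketOf σ = jacketOf τ)
    {i : Fin (D + 1)} (hi : σ i = τ i) : σ = τ := by
  have hor : ∀ k, σ k = τ k ∨ τ (σ k) = k := by
    intro k
    have h1 := (colorPairMk_mem_jacketOf (fullCycles_apply_ne hσ k).symm).2 (Or.inl rfl)
    rw [h, colorPairMk_mem_jacketOf] at h1
    exact h1.imp_left Eq.symm
  have hstep : ∀ k, σ k = τ k → σ (τ k) = τ (τ k) := by
    intro k hk
    refine (hor (τ k)).resolve_right fun h2 => ?_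
    exact fullCycles_apply_apply_ne hD hσ k (by rw [hk]; exact τ.injective h2)
  ext1 j
  obtain ⟨n, rfl⟩ := ((mem_fullCycles.1 hτ).1.sameCycle (fullCycles_apply_ne hτ i)
    (fullCycles_apply_ne hτ j)).exists_nat_pow_eq
  induction n with
  | zero => simpa using hi
  | succ n ih =>
    rw [pow_succ', Equiv.Perm.mul_apply]
    exact hstep _ ih

theorem jacketOf_eq_iff (hD : 2 ≤ D) {σ τ : Equiv.Perm (Fin (D + 1))}
    (hσ : σ ∈ fullCycles D) (hτ : τ ∈ fullCycles D) :
    jacketOf σ = jacketOf τ ↔ σ = τ ∨ σ = τ⁻¹ := by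
  constructor
  · intro h
    have h1 := (colorPairMk_mem_jacketOf (fullCycles_apply_ne hσ 0).symm).2 (Or.inl rfl)
    rw [h, colorPairMk_mem_jacketOf] at h1
    rcases h1 with h1 | h1
    · exact Or.inl (eq_of_jacketOf_eq_of_apply_eq hD hσ hτ h h1.symm)
    · refine Or.inr (eq_of_jacketOf_eq_of_apply_eq hD hσ (inv_mem_fullCycles hτ)
        (h.trans (jacketOf_inv τ).symm) (i := 0) ?_)
      rw [Equiv.Perm.eq_inv_iff_eq, h1]
  · rintro (rfl | rfl)
    · rfl
    · exact jacketOf_inv τ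

/-- Every fibre of `jacketOf` on full cycles is a pair `{τ, τ⁻¹}` of distinct elements. -/
theorem sum_fullCycles_jacketOf (hD : 2 ≤ D) (f : Finset (ColorPair D) → ℝ) :
    ∑ τ ∈ fullCycles D, f (jacketOf τ) = 2 * ∑ J ∈ jackets D, f J := by
  classical
  rw [Finset.sum_comp f jacketOf, Finset.mul_sum]
  refine Finset.sum_congr (by ext J; simp [jackets, mem_fullCycles]) fun J hJ => ?_
  obtain ⟨τ, hτ, rfl⟩ : ∃ τ ∈ fullCycles D, jacketOf τ = J := by
    simpa [jackets, mem_fullCycles] using hJ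
  have hne : τ ≠ τ⁻¹ := fun h => fullCycles_apply_apply_ne hD hτ 0 (by
    nth_rewrite 1 [h]
    simp)
  have : (fullCycles D).filter (fun σ => jacketOf σ = jacketOf τ) = {τ, τ⁻¹} := by
    ext σ
    simp only [Finset.mem_filter, Finset.mem_insert, Finset.mem_singleton]
    constructor
    · rintro ⟨h1, h2⟩
      exact (jacketOf_eq_iff hD h1 hτ).1 h2
    · rintro (rfl | rfl)
      · exact ⟨hτ, rfl⟩
      · exact ⟨inv_mem_fullCycles hτ, jacketOf_inv τ⟩
  rw [this, Finset.card_pair hne]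
  simp

theorem sum_fullCycles_sum_jacketOf (hD : 2 ≤ D) (F : ColorPair D → ℝ) :
    ∑ τ ∈ fullCycles D, ∑ c ∈ jacketOf τ, F c = 2 * ((D - 1)! : ℝ) * ∑ c, F c := by
  classical
  have : ∀ τ : Equiv.Perm (Fin (D + 1)),
      ∑ c ∈ jacketOf τ, F c = ∑ c, if c ∈ jacketOf τ then F c else 0 := by
    intro τ
    simp
  simp_rw [this]
  rw [Finset.sum_comm, Finset.mul_sum]
  refine Finset.sum_congr rfl fun c _ => ?_
  rw [← Finset.sum_filter, Finset.sum_const, card_fullCycles_mem_jacketOf hD]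
  simp

end FullCycles

/-! ### Face count and average genus -/

namespace ColoredGraph

variable {D : ℕ} {W B : Type*} [Fintype W] [Fintype B]

/-- The number of faces in terms of the degree. -/
theorem two_mul_degree (hD : 2 ≤ D) (Γ : ColoredGraph D W B) :
    2 * Γ.degree = (D ! : ℝ) * (1 + ((D : ℝ) - 1) * Fintype.card W / 2)
      - ((D - 1)! : ℝ) * ∑ c, (Fintype.card (Γ.Face c) : ℝ) := by
  have hWB : Fintype.card B = Fintype.card W := (Fintype.card_congr (Γ.line 0)).symm
  rw [degree, ← sum_fullCycles_jacketOf hD]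
  have : ∀ J, Γ.jacketGenus J = (1 + ((D : ℝ) - 1) * Fintype.card W / 2)
      - (∑ c ∈ J, (Fintype.card (Γ.Face c) : ℝ)) / 2 := by
    intro J
    simp only [jacketGenus, Fintype.card_sum, Fintype.card_prod, Fintype.card_fin, hWB]
    push_cast
    ring
  simp_rw [this]
  rw [Finset.sum_sub_distrib, ← Finset.sum_div, sum_fullCycles_sum_jacketOf hD, Finset.sum_const,
    card_fullCycles (by omega), nsmul_eq_mul]
  ring

/-- Some jacket has at most the average genus. -/
theorem exists_jacketGenus_le (hD : 2 ≤ D) (Γ : ColoredGraph D W B) :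
    ∃ τ ∈ fullCycles D, (D ! : ℝ) * Γ.jacketGenus (jacketOf τ) ≤ 2 * Γ.degree := by
  have hne : (fullCycles D).Nonempty := by
    rw [← Finset.card_pos, card_fullCycles (by omega)]
    positivity
  -- The genera of the `D!` full cycles add up to twice the degree, each jacket occurring twice.
  refine Finset.exists_le_of_sum_le hne ?_
  rw [← Finset.mul_sum, sum_fullCycles_jacketOf hD, Finset.sum_const,
    card_fullCycles (by omega), nsmul_eq_mul, degree]

end ColoredGraph

/-! ### Incidence of lines and faces in a jacket -/

namespace ColoredGraph

variable {D : ℕ} {W B : Type*}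

/-- The line `l` lies on the face `f`. -/
def LiesOn (Γ : ColoredGraph D W B) (l : Fin (D + 1) × W) (f : Σ c, Γ.Face c) : Prop :=
  (l.1 = f.1.1.1 ∨ l.1 = f.1.1.2) ∧ Quotient.mk (Equiv.Perm.SameCycle.setoid (Γ.step f.1)) l.2 = f.2

/-- The face of colours `{i, τ i}` through the white vertex `w`. -/
def jacketFace (Γ : ColoredGraph D W B) {τ : Equiv.Perm (Fin (D + 1))} (hτ : τ ∈ fullCycles D)
    (i : Fin (D + 1)) (w : W) : Σ c, Γ.Face c :=
  ⟨colorPairMk i (τ i) (fullCycles_apply_ne hτ i).symm, Quotient.mk _ w⟩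

theorem colorPair_eq_mk (c : ColorPair D) {i j : Fin (D + 1)} (h : i ≠ j)
    (hc : (c.1.1 = i ∧ c.1.2 = j) ∨ (c.1.1 = j ∧ c.1.2 = i)) : c = colorPairMk i j h := by
  obtain ⟨⟨a, b⟩, hab⟩ := c
  rcases hc with ⟨rfl, rfl⟩ | ⟨rfl, rfl⟩
  · simp [colorPairMk, le_of_lt (show a < b from hab)]
  · simp [colorPairMk, le_of_lt (show a < b from hab)]

variable (Γ : ColoredGraph D W B) {τ : Equiv.Perm (Fin (D + 1))} (hτ : τ ∈ fullCycles D)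

theorem face_mk_congr {c c' : ColorPair D} (h : c = c') (w : W) :
    (⟨c, Quotient.mk _ w⟩ : Σ c, Γ.Face c) = ⟨c', Quotient.mk _ w⟩ := by
  subst h
  rfl

theorem exists_jacketFace_eq {f : Σ c, Γ.Face c} (hf : f.1 ∈ jacketOf τ) :
    ∃ i w, Γ.jacketFace hτ i w = f := by
  obtain ⟨c, f⟩ := f
  obtain ⟨w, rfl⟩ := Quotient.exists_rep f
  rcases mem_jacketOf.1 hf with h | h
  · exact ⟨_, w, (Γ.face_mk_congr (colorPair_eq_mk c (fullCycles_apply_ne hτ c.1.1).symm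
      (Or.inl ⟨rfl, h.symm⟩)) w).symm⟩
  · exact ⟨_, w, (Γ.face_mk_congr (colorPair_eq_mk c (fullCycles_apply_ne hτ c.1.2).symm
      (Or.inr ⟨h.symm, rfl⟩)) w).symm⟩

theorem liesOn_jacketFace (i : Fin (D + 1)) (w : W) :
    Γ.LiesOn (i, w) (Γ.jacketFace hτ i w) := by
  refine ⟨?_, rfl⟩
  rcases le_total i (τ i) with h | h <;> simp [jacketFace, colorPairMk, h]

theorem liesOn_jacketFace_apply (i : Fin (D + 1)) (w : W) :
    Γ.LiesOn (τ i, w) (Γ.jacketFace hτ i w) := by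
  refine ⟨?_, rfl⟩
  rcases le_total i (τ i) with h | h <;> simp [jacketFace, colorPairMk, h]

/-- A line of colour `τ i` lies on two faces of the jacket only. -/
theorem eq_jacketFace_of_liesOn {i : Fin (D + 1)} {w : W} {f : Σ c, Γ.Face c}
    (hf : f.1 ∈ jacketOf τ) (h : Γ.LiesOn (τ i, w) f) :
    f = Γ.jacketFace hτ i w ∨ f = Γ.jacketFace hτ (τ i) w := by
  obtain ⟨c, f⟩ := f
  obtain ⟨h1, h2⟩ := h
  dsimp only at hf h1 h2
  subst h2
  have key : c = colorPairMk i (τ i) (fullCycles_apply_ne hτ i).symm ∨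
      c = colorPairMk (τ i) (τ (τ i)) (fullCycles_apply_ne hτ (τ i)).symm := by
    rcases mem_jacketOf.1 hf with h | h <;> rcases h1 with h1 | h1
    · exact Or.inr (colorPair_eq_mk c _ (Or.inl ⟨h1.symm, by rw [← h, h1]⟩))
    · exact Or.inl (colorPair_eq_mk c _ (Or.inl ⟨τ.injective (h.trans h1.symm), h1.symm⟩))
    · exact Or.inl (colorPair_eq_mk c _ (Or.inr ⟨h1.symm, τ.injective (h.trans h1.symm)⟩))
    · exact Or.inr (colorPair_eq_mk c _ (Or.inr ⟨by rw [← h, h1], h1.symm⟩))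
  rcases key with rfl | rfl
  · exact Or.inl rfl
  · exact Or.inr rfl

/-- Two lines with consecutive colours which meet at a black vertex share a face. -/
theorem jacketFace_eq_of_line_eq {i : Fin (D + 1)} {w w' : W}
    (h : Γ.line i w = Γ.line (τ i) w') : Γ.jacketFace hτ i w = Γ.jacketFace hτ i w' := by
  have hs : (Γ.step (colorPairMk i (τ i) (fullCycles_apply_ne hτ i).symm)).SameCycle w w' := by
    rcases le_total i (τ i) with hi | hi
    · refine ⟨1, ?_⟩
      simp [step, colorPairMk, hi, h]
    · refine ⟨-1, ?_⟩
      rw [zpow_neg_one, Equiv.Perm.inv_eq_iff_eq]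
      simp [step, colorPairMk, hi, ← h]
  exact Sigma.ext rfl (heq_of_eq (Quotient.sound hs))

/-- In the graph whose vertices are the faces of a jacket and whose lines are those of the coloured
graph, a non-trivial cut has a line. -/
theorem exists_liesOn_unique {τ : Equiv.Perm (Fin (D + 1))} (hτ : τ ∈ fullCycles D)
    (hΓ : Γ.IsConnected) {S : Finset (Σ c, Γ.Face c)}
    (hS : ∀ f ∈ S, f.1 ∈ jacketOf τ) (hne : S.Nonempty)
    (hlt : ∃ f : Σ c, Γ.Face c, f.1 ∈ jacketOf τ ∧ f ∉ S) :
    ∃ l, ∃ f ∈ S, Γ.LiesOn l f ∧ ∀ f' ∈ S, Γ.LiesOn l f' → f' = f := by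
  by_contra hcon
  push Not at hcon
  -- If just one of the two jacket faces through the line `(τ i, w)` were in `S`, that line would
  -- lie on a single face of `S`.
  have hstep : ∀ w i, Γ.jacketFace hτ i w ∈ S ↔ Γ.jacketFace hτ (τ i) w ∈ S := by
    intro w i
    constructor <;> intro h <;> by_contra h'
    · obtain ⟨f', hf', hl, hne'⟩ := hcon (τ i, w) _ h (Γ.liesOn_jacketFace_apply hτ i w)
      rcases Γ.eq_jacketFace_of_liesOn hτ (hS f' hf') hl with rfl | rfl
      · exact hne' rfl
      · exact h' hf'
    · obtain ⟨f', hf', hl, hne'⟩ := hcon (τ i, w) _ h (Γ.liesOn_jacketFace hτ (τ i) w)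
      rcases Γ.eq_jacketFace_of_liesOn hτ (hS f' hf') hl with rfl | rfl
      · exact h' hf'
      · exact hne' rfl
  have hcol : ∀ w i j, Γ.jacketFace hτ i w ∈ S ↔ Γ.jacketFace hτ j w ∈ S := fun w =>
    fullCycles_iff_of_invariant hτ (hstep w)
  -- The lines of colours `i` and `τ i` at `b` share a jacket face, so membership in `S` passes
  -- between their white ends.
  have hblack : ∀ b i j, Γ.jacketFace hτ 0 ((Γ.line i).symm b) ∈ S ↔
      Γ.jacketFace hτ 0 ((Γ.line j).symm b) ∈ S := fun b =>
    fullCycles_iff_of_invariant hτ fun i => by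
      rw [hcol _ 0 i, Γ.jacketFace_eq_of_line_eq hτ (w' := (Γ.line (τ i)).symm b) (by simp),
        hcol _ i 0]
  let Q : W ⊕ B → Prop := Sum.elim (fun w => Γ.jacketFace hτ 0 w ∈ S)
    fun b => Γ.jacketFace hτ 0 ((Γ.line 0).symm b) ∈ S
  have hline : ∀ c w, Q (Sum.inl w) ↔ Q (Sum.inr (Γ.line c w)) := by
    intro c w
    have := hblack (Γ.line c w) c 0
    rwa [Equiv.symm_apply_apply] at this
  have hadj : ∀ x y, Γ.toSimpleGraph.Adj x y → (Q x ↔ Q y) := by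
    rintro x y ⟨-, ⟨c, w, rfl, rfl⟩ | ⟨c, w, rfl, rfl⟩⟩
    · exact hline c w
    · exact (hline c w).symm
  have hall : ∀ x y, Q x ↔ Q y := by
    intro x y
    obtain ⟨p⟩ := hΓ.preconnected x y
    induction p with
    | nil => exact Iff.rfl
    | cons h _ ih => exact (hadj _ _ h).trans ih
  obtain ⟨f, hf⟩ := hne
  obtain ⟨f', hf', hf'S⟩ := hlt
  obtain ⟨i, w, rfl⟩ := Γ.exists_jacketFace_eq hτ (hS f hf)
  obtain ⟨i', w', rfl⟩ := Γ.exists_jacketFace_eq hτ hf'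
  exact hf'S ((hcol w' 0 i').1 ((hall (Sum.inl w) (Sum.inl w')).1 ((hcol w i 0).1 hf)))

end ColoredGraph

/-! ### Dependence of a holonomy on a single line -/

namespace ColoredGraph

variable {D : ℕ} {W B : Type*} {G : Type*} [Group G]

/-- The part of the holonomy which follows its first two factors. -/
noncomputable def holonomyTail (Γ : ColoredGraph D W B) (c : ColorPair D)
    (h : Fin (D + 1) × W → G) (w : W) : G :=
  ((List.range (Function.minimalPeriod (Γ.step c) w - 1)).map fun k =>
    h (c.1.1, ((Γ.step c)^[k + 1]) w) * (h (c.1.2, ((Γ.step c)^[k + 2]) w))⁻¹).prod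

theorem holonomy_eq_mul_tail [Finite W] (Γ : ColoredGraph D W B) (c : ColorPair D)
    (h : Fin (D + 1) × W → G) (w : W) :
    Γ.holonomy c h w =
      h (c.1.1, w) * (h (c.1.2, Γ.step c w))⁻¹ * Γ.holonomyTail c h w := by
  have hpos : 0 < Function.minimalPeriod (Γ.step c) w :=
    Function.minimalPeriod_pos_of_mem_periodicPts ((Γ.step c).injective.mem_periodicPts w)
  obtain ⟨m, hm⟩ := Nat.exists_eq_succ_of_ne_zero hpos.ne'
  unfold holonomy holonomyTail
  rw [hm, Nat.succ_eq_add_one, List.prod_range_succ', Nat.add_sub_cancel]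
  rfl

theorem iterate_step_ne (Γ : ColoredGraph D W B) (c : ColorPair D) (w : W) {k : ℕ}
    (hk : k < Function.minimalPeriod (Γ.step c) w - 1) : ((Γ.step c)^[k + 1]) w ≠ w := fun h =>
  Function.not_isPeriodicPt_of_pos_of_lt_minimalPeriod (Nat.succ_ne_zero k) (by omega) h

-- A face passes only once through each of its lines: the colours of `c` differ, and the walk does
-- not return to `w` before its period.
open Classical in
theorem holonomyTail_update_fst (Γ : ColoredGraph D W B) (c : ColorPair D)
    (h : Fin (D + 1) × W → G) (w : W) (t : G) :
    Γ.holonomyTail c (Function.update h (c.1.1, w) t) w = Γ.holonomyTail c h w := by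
  unfold holonomyTail
  congr 1
  refine List.map_congr_left fun k hk => ?_
  rw [Function.update_of_ne, Function.update_of_ne]
  · exact fun e => c.2.ne' (Prod.ext_iff.1 e).1
  · exact fun e => Γ.iterate_step_ne c w (List.mem_range.1 hk) (Prod.ext_iff.1 e).2

open Classical in
theorem holonomyTail_update_snd (Γ : ColoredGraph D W B) (c : ColorPair D)
    (h : Fin (D + 1) × W → G) (w : W) (t : G) :
    Γ.holonomyTail c (Function.update h (c.1.2, Γ.step c w) t) w = Γ.holonomyTail c h w := by
  unfold holonomyTail
  congr 1
  refine List.map_congr_left fun k hk => ?_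
  rw [Function.update_of_ne, Function.update_of_ne]
  · intro e
    have e2 := (Prod.ext_iff.1 e).2
    rw [Function.iterate_succ_apply'] at e2
    exact Γ.iterate_step_ne c w (List.mem_range.1 hk) ((Γ.step c).injective e2)
  · exact fun e => c.2.ne (Prod.ext_iff.1 e).1

theorem sameCycle_out (Γ : ColoredGraph D W B) (c : ColorPair D) (w : W) :
    (Γ.step c).SameCycle
      (Quotient.out (Quotient.mk (Equiv.Perm.SameCycle.setoid (Γ.step c)) w)) w :=
  Quotient.exact (Quotient.out_eq (Quotient.mk (Equiv.Perm.SameCycle.setoid (Γ.step c)) w))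

open Classical in
/-- The holonomy of a face does not depend on the lines off that face. -/
theorem faceHolonomy_update_of_not_liesOn (Γ : ColoredGraph D W B) {l : Fin (D + 1) × W}
    {f : Σ c, Γ.Face c} (hl : ¬ Γ.LiesOn l f) (h : Fin (D + 1) × W → G) (t : G) :
    Γ.faceHolonomy f.2 (Function.update h l t) = Γ.faceHolonomy f.2 h := by
  have hk : ∀ (i : Fin (D + 1)) (k : ℕ), i = f.1.1.1 ∨ i = f.1.1.2 →
      (i, ((Γ.step f.1)^[k]) (Quotient.out f.2)) ≠ l := by
    rintro i k hi rfl
    refine hl ⟨hi, ?_⟩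
    conv_rhs => rw [← Quotient.out_eq f.2]
    refine Quotient.sound (Equiv.Perm.SameCycle.symm ⟨k, ?_⟩)
    rw [zpow_natCast, Equiv.Perm.iterate_eq_pow]
  unfold faceHolonomy holonomy
  congr 1
  refine List.map_congr_left fun k _ => ?_
  rw [Function.update_of_ne (hk _ _ (Or.inl rfl)), Function.update_of_ne (hk _ _ (Or.inr rfl))]

end ColoredGraph

theorem continuous_faceHolonomy {G : Type*} [Group G] [TopologicalSpace G] [IsTopologicalGroup G]
    {D : ℕ} {W B : Type*} (Γ : ColoredGraph D W B) {c : ColorPair D} (f : Γ.Face c) :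
    Continuous fun h : Fin (D + 1) × W → G => Γ.faceHolonomy f h := by
  unfold ColoredGraph.faceHolonomy ColoredGraph.holonomy
  refine continuous_list_prod _ fun k _ => ?_
  fun_prop

/-! ### Integrating out the faces of a jacket -/

section Delta

variable {G : Type*} [Group G] [TopologicalSpace G] [IsTopologicalGroup G] [CompactSpace G]
  [MeasurableSpace G] [BorelSpace G] {D : ℕ} {W B : Type*}

instance : IsProbabilityMeasure (normalizedHaar G) :=
  ⟨Measure.haarMeasure_self (K₀ := (⊤ : TopologicalSpace.PositiveCompacts G))⟩

instance : (normalizedHaar G).IsMulLeftInvariant :=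
  inferInstanceAs (Measure.haarMeasure (⊤ : TopologicalSpace.PositiveCompacts G)).IsMulLeftInvariant

open Classical in
/-- As a function of one line of a face, the factor of that face is a translate of `δ`. -/
theorem IsRegularizedDelta.exists_faceHolonomy_update [Finite W] {δ : G → ℝ}
    (hδ : IsRegularizedDelta δ) (Γ : ColoredGraph D W B) {l : Fin (D + 1) × W}
    {f : Σ c, Γ.Face c} (hl : Γ.LiesOn l f) (h : Fin (D + 1) × W → G) :
    ∃ a : G, ∀ t, δ (Γ.faceHolonomy f.2 (Function.update h l t)) = δ (a * t) := by
  obtain ⟨c, f⟩ := f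
  obtain ⟨i, w⟩ := l
  obtain ⟨hi, hw⟩ := hl
  dsimp only at hi hw
  subst hw
  rcases hi with rfl | rfl
  -- Started at `w`, the holonomy begins with `t`; centrality moves `t` to the end.
  · refine ⟨(h (c.1.2, Γ.step c w))⁻¹ * Γ.holonomyTail c h w, fun t => ?_⟩
    unfold ColoredGraph.faceHolonomy
    rw [hδ.holonomy_sameCycle Γ c _ (Γ.sameCycle_out c w), Γ.holonomy_eq_mul_tail,
      Γ.holonomyTail_update_fst, Function.update_self, Function.update_of_ne, mul_assoc, hδ.central]
    exact fun e => c.2.ne' (Prod.ext_iff.1 e).1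
  -- Started one step earlier, at `v`, the holonomy has `t⁻¹` as its second factor; inversion
  -- invariance and centrality then bring `t` to the end.
  · obtain ⟨v, rfl⟩ := (Γ.step c).surjective w
    refine ⟨(h (c.1.1, v))⁻¹ * (Γ.holonomyTail c h v)⁻¹, fun t => ?_⟩
    have hv : (Γ.step c).SameCycle (Γ.step c v) v := Equiv.Perm.SameCycle.symm ⟨1, by simp⟩
    unfold ColoredGraph.faceHolonomy
    rw [hδ.holonomy_sameCycle Γ c _ ((Γ.sameCycle_out c _).trans hv), Γ.holonomy_eq_mul_tail,
      Γ.holonomyTail_update_snd, Function.update_self, Function.update_of_ne, ← hδ.inv,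
      mul_inv_rev, mul_inv_rev, inv_inv, ← mul_assoc, hδ.central, ← mul_assoc]
    exact fun e => c.2.ne (Prod.ext_iff.1 e).1

theorem IsRegularizedDelta.lintegral_mul_left {δ : G → ℝ} (hδ : IsRegularizedDelta δ) (a : G) :
    ∫⁻ t, ENNReal.ofReal (δ (a * t)) ∂(normalizedHaar G) = 1 := by
  rw [lintegral_mul_left_eq_self (fun t => ENNReal.ofReal (δ t)) a,
    ← ofReal_integral_eq_lintegral_ofReal, hδ.integral_eq_one, ENNReal.ofReal_one]
  -- A non-integrable `δ` would have integral `0` by convention, not `1`.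
  · by_contra hint
    have := hδ.integral_eq_one
    rw [integral_undef hint] at this
    exact zero_ne_one this
  · exact Filter.Eventually.of_forall hδ.nonneg

theorem IsRegularizedDelta.one_le {δ : G → ℝ} (hδ : IsRegularizedDelta δ) : 1 ≤ δ 1 := by
  have h : ∫⁻ t, ENNReal.ofReal (δ (1 * t)) ∂(normalizedHaar G)
      ≤ ∫⁻ _, ENNReal.ofReal (δ 1) ∂(normalizedHaar G) :=
    lintegral_mono fun t => ENNReal.ofReal_le_ofReal (hδ.le_unit _)
  rw [hδ.lintegral_mul_left, lintegral_const, measure_univ, mul_one] at h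
  simpa using h

variable [SecondCountableTopology G] [Fintype W]

theorem IsRegularizedDelta.measurable_ofReal_prod {δ : G → ℝ} (hδ : IsRegularizedDelta δ)
    (Γ : ColoredGraph D W B) (S : Finset (Σ c, Γ.Face c)) :
    Measurable fun h : Fin (D + 1) × W → G =>
      ∏ f ∈ S, ENNReal.ofReal (δ (Γ.faceHolonomy f.2 h)) :=
  Finset.measurable_prod _ fun f _ =>
    (hδ.continuous.comp (continuous_faceHolonomy Γ f.2)).measurable.ennreal_ofReal

/-- The product over a proper subset of the faces of a jacket has integral one. -/
theorem IsRegularizedDelta.lintegral_prod_eq_one {δ : G → ℝ} (hδ : IsRegularizedDelta δ)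
    (Γ : ColoredGraph D W B) (hΓ : Γ.IsConnected) {τ : Equiv.Perm (Fin (D + 1))}
    (hτ : τ ∈ fullCycles D) (S : Finset (Σ c, Γ.Face c)) (hS : ∀ f ∈ S, f.1 ∈ jacketOf τ)
    (hlt : ∃ f : Σ c, Γ.Face c, f.1 ∈ jacketOf τ ∧ f ∉ S) :
    ∫⁻ h : Fin (D + 1) × W → G, ∏ f ∈ S, ENNReal.ofReal (δ (Γ.faceHolonomy f.2 h))
      ∂(Measure.pi fun _ => normalizedHaar G) = 1 := by
  classical
  induction S using Finset.strongInduction with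
  | H S ih =>
    rcases S.eq_empty_or_nonempty with rfl | hne
    · simp
    obtain ⟨l, f, hf, hl, huniq⟩ := Γ.exists_liesOn_unique hτ hΓ hS hne hlt
    obtain ⟨f₀, hf₀, hf₀S⟩ := hlt
    rw [← ih (S.erase f) (Finset.erase_ssubset hf)
      (fun g hg => hS g (Finset.mem_of_mem_erase hg))
      ⟨f₀, hf₀, fun hm => hf₀S (Finset.mem_of_mem_erase hm)⟩]
    -- It suffices to compare the partial integrals over the line `l`, on which only the factor of
    -- `f` depends.
    refine lintegral_eq_of_lmarginal_eq {l} (hδ.measurable_ofReal_prod Γ S)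
      (hδ.measurable_ofReal_prod Γ (S.erase f)) ?_
    rw [lmarginal_singleton, lmarginal_singleton]
    funext h
    have hconst : ∀ t, ∏ g ∈ S.erase f,
        ENNReal.ofReal (δ (Γ.faceHolonomy g.2 (Function.update h l t))) =
        ∏ g ∈ S.erase f, ENNReal.ofReal (δ (Γ.faceHolonomy g.2 h)) := fun t =>
      Finset.prod_congr rfl fun g hg => by
        rw [Γ.faceHolonomy_update_of_not_liesOn fun hg' => Finset.ne_of_mem_erase hg
          (huniq g (Finset.mem_of_mem_erase hg) hg')]
    obtain ⟨a, ha⟩ := hδ.exists_faceHolonomy_update Γ hl h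
    simp_rw [← Finset.mul_prod_erase S _ hf, hconst, ha]
    rw [lintegral_mul_const _ (by
      exact (hδ.continuous.measurable.comp (measurable_const_mul a)).ennreal_ofReal),
      hδ.lintegral_mul_left, lintegral_const, measure_univ, one_mul, mul_one]

end Delta

/-! ### The jacket bound -/

section JacketBound

variable {G : Type*} [Group G] [TopologicalSpace G] [IsTopologicalGroup G] [CompactSpace G]
  [SecondCountableTopology G] [MeasurableSpace G] [BorelSpace G] {D : ℕ} {W B : Type*} [Fintype W]

/-- The integral of the product over all the faces is at most `δ(e)` to the number of faces off a
jacket plus one. -/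
theorem IsRegularizedDelta.integral_le {δ : G → ℝ} (hδ : IsRegularizedDelta δ)
    (Γ : ColoredGraph D W B) (hΓ : Γ.IsConnected) {τ : Equiv.Perm (Fin (D + 1))}
    (hτ : τ ∈ fullCycles D) :
    ∫ h : Fin (D + 1) × W → G, ∏ c : ColorPair D, ∏ f : Γ.Face c, δ (Γ.faceHolonomy f h)
        ∂(Measure.pi fun _ => normalizedHaar G)
      ≤ δ 1 ^ ((∑ c, (Fintype.card (Γ.Face c) : ℝ))
        - (∑ c ∈ jacketOf τ, (Fintype.card (Γ.Face c) : ℝ)) + 1) := by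
  classical
  obtain ⟨x⟩ := hΓ.nonempty
  have w : W := x.elim id (Γ.line 0).symm
  let J : Finset (Σ c, Γ.Face c) := Finset.univ.filter fun f => f.1 ∈ jacketOf τ
  have hJ : (J.card : ℝ) = ∑ c ∈ jacketOf τ, (Fintype.card (Γ.Face c) : ℝ) := by
    have : J = (jacketOf τ).sigma fun _ => Finset.univ := by
      ext f
      simp [J]
    rw [this, Finset.card_sigma]
    simp
  let f₀ := Γ.jacketFace hτ 0 w
  have hf₀ : f₀.1 ∈ jacketOf τ :=
    (colorPairMk_mem_jacketOf (fullCycles_apply_ne hτ 0).symm).2 (Or.inl rfl)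
  have hf₀J : f₀ ∈ J := by simp [J, hf₀]
  -- Dropping one face makes `S` a proper subset; this is the `+ 1` in the exponent.
  let S := J.erase f₀
  have hS : (S.card : ℝ) + 1 = ∑ c ∈ jacketOf τ, (Fintype.card (Γ.Face c) : ℝ) := by
    rw [← hJ, ← Finset.card_erase_add_one hf₀J]
    push_cast
    rfl
  have hone := hδ.lintegral_prod_eq_one Γ hΓ hτ S
    (fun f hf => (Finset.mem_filter.1 (Finset.mem_of_mem_erase hf)).2)
    ⟨f₀, hf₀, Finset.notMem_erase _ _⟩
  have hSc : (Sᶜ.card : ℝ) = (∑ c, (Fintype.card (Γ.Face c) : ℝ))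
      - (∑ c ∈ jacketOf τ, (Fintype.card (Γ.Face c) : ℝ)) + 1 := by
    rw [← hS, Finset.card_compl, Nat.cast_sub (Finset.card_le_univ S), Fintype.card_sigma]
    push_cast
    ring
  rw [← hSc, Real.rpow_natCast]
  have hpt : ∀ h : Fin (D + 1) × W → G,
      ENNReal.ofReal (∏ c : ColorPair D, ∏ f : Γ.Face c, δ (Γ.faceHolonomy f h)) ≤
        ENNReal.ofReal (δ 1 ^ Sᶜ.card) * ∏ f ∈ S, ENNReal.ofReal (δ (Γ.faceHolonomy f.2 h)) := by
    intro h
    rw [← Fintype.prod_sigma' (fun c (f : Γ.Face c) => δ (Γ.faceHolonomy f h)),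
      ← Finset.prod_compl_mul_prod S,
      ENNReal.ofReal_mul (Finset.prod_nonneg fun _ _ => hδ.nonneg _),
      ENNReal.ofReal_prod_of_nonneg (s := S) fun _ _ => hδ.nonneg _]
    gcongr
    rw [← Finset.prod_const]
    exact Finset.prod_le_prod (fun _ _ => hδ.nonneg _) fun _ _ => hδ.le_unit _
  have hle : ∫⁻ h : Fin (D + 1) × W → G,
      ENNReal.ofReal (∏ c : ColorPair D, ∏ f : Γ.Face c, δ (Γ.faceHolonomy f h))
        ∂(Measure.pi fun _ => normalizedHaar G) ≤ ENNReal.ofReal (δ 1 ^ Sᶜ.card) := by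
    refine (lintegral_mono hpt).trans ?_
    rw [lintegral_const_mul _ (hδ.measurable_ofReal_prod Γ S), hone, mul_one]
  rw [integral_eq_lintegral_of_nonneg_ae]
  · exact ENNReal.toReal_le_of_le_ofReal (pow_nonneg (hδ.nonneg 1) _) hle
  · exact Filter.Eventually.of_forall fun h =>
      Finset.prod_nonneg fun _ _ => Finset.prod_nonneg fun _ _ => hδ.nonneg _
  · refine Measurable.aestronglyMeasurable (Finset.measurable_prod _ fun c _ =>
      Finset.measurable_prod _ fun f _ => ?_)
    exact (hδ.continuous.comp (continuous_faceHolonomy Γ f)).measurable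

end JacketBound

theorem mainTheorem2 {G : Type*} [Group G] [TopologicalSpace G] [IsTopologicalGroup G]
    [CompactSpace G] [SecondCountableTopology G] [MeasurableSpace G] [BorelSpace G]
    {D : ℕ} (hD : 2 ≤ D) {W B : Type*} [Fintype W] [Fintype B]
    (Γ : ColoredGraph D W B) (hΓ : Γ.IsConnected)
    (p : ℕ) (hp : Fintype.card (W ⊕ B) = 2 * p)
    (δ : G → ℝ) (hδ : IsRegularizedDelta δ) (lam : ℂ) :
    Γ.amplitude δ lam ≤
      Complex.normSq lam ^ p
        * δ 1 ^ ((D : ℝ) - 1 - 2 * ((D : ℝ) - 2) / (D ! : ℝ) * Γ.degree) := by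
  have hWB : Fintype.card B = Fintype.card W := (Fintype.card_congr (Γ.line 0)).symm
  have hW : Fintype.card W = p := by
    rw [Fintype.card_sum, hWB] at hp
    omega
  obtain ⟨τ, hτ, hg⟩ := Γ.exists_jacketGenus_le hD
  have hdeg := Γ.two_mul_degree hD
  have hδ1 := hδ.one_le
  have hpos : 0 < δ 1 := one_pos.trans_le hδ1
  have hI := hδ.integral_le Γ hΓ hτ
  have hgenus : Γ.jacketGenus (jacketOf τ) = (2 - (2 * (p : ℝ) - (D + 1) * p
      + ∑ c ∈ jacketOf τ, (Fintype.card (Γ.Face c) : ℝ))) / 2 := by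
    simp only [ColoredGraph.jacketGenus, Fintype.card_sum, Fintype.card_prod, Fintype.card_fin,
      hWB, hW]
    push_cast
    ring
  rw [hW] at hdeg
  have hfact : (D ! : ℝ) = D * ((D - 1)! : ℝ) := by
    exact_mod_cast (Nat.mul_factorial_pred (by omega : D ≠ 0)).symm
  have hm : (0 : ℝ) < ((D - 1)! : ℝ) := by positivity
  have hD0 : (0 : ℝ) < D := by positivity
  unfold ColoredGraph.amplitude
  rw [hW, div_mul_eq_mul_div, mul_div_assoc]
  refine mul_le_mul_of_nonneg_left ?_ (pow_nonneg (Complex.normSq_nonneg _) _)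
  refine (div_le_div_of_nonneg_right hI (Real.rpow_nonneg hpos.le _)).trans ?_
  rw [← Real.rpow_sub hpos]
  refine Real.rpow_le_rpow_of_exponent_le hδ1 ?_
  generalize (∑ c, (Fintype.card (Γ.Face c) : ℝ)) = F at *
  generalize (∑ c ∈ jacketOf τ, (Fintype.card (Γ.Face c) : ℝ)) = FJ at *
  rw [hgenus] at hg
  -- In terms of `x = ω / D!` both the face count `e1` and the genus bound `e2` are free of
  -- factorials, and the exponents compare linearly.
  set x := Γ.degree / (D ! : ℝ) with hx
  have hω : Γ.degree = D * ((D - 1)! : ℝ) * x := by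
    rw [hx, hfact]
    field_simp
  have e1 : F = D + (p : ℝ) * D * (D - 1) / 2 - 2 * D * x := by
    rw [hω, hfact] at hdeg
    refine mul_left_cancel₀ hm.ne' ?_
    linarith
  have e2 : (2 - (2 * (p : ℝ) - (D + 1) * p + FJ)) / 2 ≤ 2 * x := by
    rw [hω, hfact] at hg
    refine le_of_mul_le_mul_left ?_ (mul_pos hD0 hm)
    linarith
  have e3 : 2 * ((D : ℝ) - 2) / (D ! : ℝ) * Γ.degree = 2 * ((D : ℝ) - 2) * x := by
    rw [hx]
    ring
  rw [e3, e1]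
  linarith
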